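/- Let $l,n_1,n_2\ge 0$ be integers with $\gcd(l,n_1)=\gcd(l,n_2)=1$ (where $\gcd(l,0)=l$, so that $l=1$ if $n_1=0$ or $n_2=0$). Regard $\mathrm{SU}(2)$ as the unit quaternions, $S^1=\{e^{i\theta}\}\subset\mathbb C\subset\mathbb H$, and $S^3\subset\mathbb C^2$. Let $S^1$ act on $\mathrm{SU}(2)\times S^3$ by $x*(p,(z_1,z_2))=(px^l,(x^{n_1}z_1,x^{n_2}z_2))$, let $N^l_{n_1,n_2}$ be the quotient manifold, and let $\mathrm{SU}(2)$ act on it by $g\cdot[(p,v)]=[(gp,v)]$. A principal isotropy group of an action is an isotropy group that is conjugate to a subgroup of every isotropy group. Proposition. Suppose that a principal isotropy group $H$ of $N^l_{n_1,n_2}$ is isomorphic to $\mathbb Z_d$ with $d\ge 3$. Then: (1) $l\ge 1$, the group $\mathbb Z_l$ of $l$-th roots of unity acts freely on $S^3$ by $\xi\cdot(z_1,z_2)=(\xi^{n_1}z_1,\xi^{n_2}z_2)$, and the fixed point set $(N^l_{n_1,n_2})^H$ is diffeomorphic to the disjoint union of two copies of the lens space $S^3/\mathbb Z_l$ for this action.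 (2) The fixed point set determines $l$. That is, let $l',n_1',n_2'\ge 0$ be integers with $\gcd(l',n_1')=\gcd(l',n_2')=1$, and let $H'\cong\mathbb Z_{d'}$ with $d'\ge 3$ be a principal isotropy group of $N^{l'}_{n_1',n_2'}$. If $(N^l_{n_1,n_2})^H$ and $(N^{l'}_{n_1',n_2'})^{H'}$ are homeomorphic, then $l=l'$. (3) Consequently, for any integers $l',n_1',n_2'\ge 0$ with $\gcd(l',n_1')=\gcd(l',n_2')=1$, if $N^l_{n_1,n_2}$ and $N^{l'}_{n_1',n_2'}$ are $\mathrm{SU}(2)$-equivariantly homeomorphic (in particular if they are equivariantly diffeomorphic), then $l=l'$. -/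

import Mathlib

open scoped Quaternion Manifold ContDiff

noncomputable section

/-- The group `SU(2)`, regarded as the group of unit quaternions. -/
abbrev SU2 : Type := Metric.sphere (0 : ℍ[ℝ]) 1

/-- The unit sphere `S³` of `ℂ²`. -/
abbrev S3 : Type := Metric.sphere (0 : EuclideanSpace ℂ (Fin 2)) 1

instance finrank_quaternion_fact : Fact (Module.finrank ℝ ℍ[ℝ] = 3 + 1) :=
  ⟨Quaternion.finrank_eq_four⟩

instance finrank_complexPlane_fact :
    Fact (Module.finrank ℝ (EuclideanSpace ℂ (Fin 2)) = 3 + 1) :=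
  ⟨by rw [← Module.finrank_mul_finrank ℝ ℂ (EuclideanSpace ℂ (Fin 2))]; simp⟩

/-- The inclusion `S¹ ⊆ SU(2)` that sends `e^{iθ}` to `cos θ + (sin θ) i`. -/
def circleToSU2 : Circle →* SU2 where
  toFun x := ⟨Quaternion.ofComplex (x : ℂ), by
    have h : Complex.normSq (x : ℂ) = 1 := x.normSq_coe
    rw [Complex.normSq_apply] at h
    have h' : ‖Quaternion.ofComplex (x : ℂ)‖ ^ 2 = 1 := by
      rw [sq, ← Quaternion.normSq_eq_norm_mul_self, Quaternion.normSq_def']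
      simp only [Quaternion.coe_ofComplex, Quaternion.re_coeComplex, Quaternion.imI_coeComplex,
        Quaternion.imJ_coeComplex, Quaternion.imK_coeComplex]
      linarith
    rw [mem_sphere_zero_iff_norm]
    exact (pow_eq_one_iff_of_nonneg (norm_nonneg _) two_ne_zero).1 h'⟩
  map_one' := by ext1; simp
  map_mul' x y := by ext1; simp

/-- The linear circle action on `S³` with weights `(m, n)`:
`x · (z, w) = (x ^ m z, x ^ n w)`. -/
@[reducible] def weightedAction (m n : ℕ) : MulAction Circle S3 where
  smul x v := ⟨!₂[(x : ℂ) ^ m * v.1 0, (x : ℂ) ^ n * v.1 1], by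
    have h := v.2
    simp only [mem_sphere_iff_norm, sub_zero, EuclideanSpace.norm_eq, Fin.sum_univ_two] at h ⊢
    have hx : ‖(x : ℂ)‖ = 1 := x.norm_coe
    simpa [hx] using h⟩
  one_smul v := by
    ext i
    change (!₂[((1 : Circle) : ℂ) ^ m * v.1 0, ((1 : Circle) : ℂ) ^ n * v.1 1]).ofLp i = v.1 i
    fin_cases i <;> simp
  mul_smul x y v := by
    ext i
    change (!₂[((x * y : Circle) : ℂ) ^ m * v.1 0, ((x * y : Circle) : ℂ) ^ n * v.1 1]).ofLp i =
      (!₂[(x : ℂ) ^ m * ((y : ℂ) ^ m * v.1 0), (x : ℂ) ^ n * ((y : ℂ) ^ n * v.1 1)]).ofLp i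
    fin_cases i <;> simp [mul_pow, mul_assoc]

/-- The circle action `x * (p, (z, w)) = (p x ^ l, (x ^ m z, x ^ n w))` on `SU(2) × S³`. -/
@[reducible] def circleAction (l m n : ℕ) : MulAction Circle (SU2 × S3) where
  smul x a := (a.1 * circleToSU2 x ^ l, (weightedAction m n).smul x a.2)
  one_smul a := Prod.ext
    (by change a.1 * circleToSU2 1 ^ l = a.1; simp)
    ((weightedAction m n).one_smul a.2)
  mul_smul x y a := Prod.ext
    (by
      change a.1 * circleToSU2 (x * y) ^ l = a.1 * circleToSU2 y ^ l * circleToSU2 x ^ l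
      rw [mul_comm x y, map_mul, mul_assoc, Commute.mul_pow]
      rw [commute_iff_eq, ← map_mul, ← map_mul, mul_comm])
    ((weightedAction m n).mul_smul x y a.2)

/-- The space `N^l_{m,n} = SU(2) ×_{S¹} S³` of orbits of the circle action on `SU(2) × S³`. -/
def NSpace (l m n : ℕ) : Type :=
  Quotient (@MulAction.orbitRel Circle (SU2 × S3) _ (circleAction l m n))

namespace NSpace

/-- The class `[(p, v)]`. -/
def mk (l m n : ℕ) (a : SU2 × S3) : NSpace l m n := Quotient.mk _ a

/-- The quotient topology. -/
instance (l m n : ℕ) : TopologicalSpace (NSpace l m n) :=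
  inferInstanceAs (TopologicalSpace (Quotient _))

/-- The action of `SU(2)` by `g · [(p, v)] = [(g p, v)]`. -/
instance (l m n : ℕ) : MulAction SU2 (NSpace l m n) where
  smul g := Quotient.map' (fun a : SU2 × S3 => (g * a.1, a.2)) (by
    rintro a b ⟨x, rfl⟩
    exact ⟨x, Prod.ext (mul_assoc g b.1 _) rfl⟩)
  one_smul q := by
    induction q using Quotient.inductionOn' with
    | h a => exact congrArg (mk l m n) (Prod.ext (one_mul a.1) rfl)
  mul_smul g h q := by
    induction q using Quotient.inductionOn' with
    | h a => exact congrArg (mk l m n) (Prod.ext (mul_assoc g h a.1) rfl)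

/-- The smooth real functions on `N^l_{m,n}`: those whose pull-back to `SU(2) × S³` is smooth.
This is the quotient smooth structure when the circle action is free. -/
def smoothFunctions (l m n : ℕ) : Set (NSpace l m n → ℝ) :=
  {f | ContMDiff ((𝓡 3).prod (𝓡 3)) 𝓘(ℝ, ℝ) ∞ (fun a : SU2 × S3 => f (mk l m n a))}

end NSpace

/-- The group `ℤ_l` of `l`-th roots of unity, as a subgroup of the circle. -/
def rootsSubgroup (l : ℕ) : Subgroup Circle := (powMonoidHom l : Circle →* Circle).ker

/-- The action of `ℤ_l` on `S³` by `ξ · (z, w) = (ξ ^ m z, ξ ^ n w)`. -/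
@[reducible] def rootsAction (l m n : ℕ) : MulAction (rootsSubgroup l) S3 :=
  letI := weightedAction m n
  inferInstance

/-- The quotient `S³ / ℤ_l` for the action `ξ · (z, w) = (ξ ^ m z, ξ ^ n w)`. It is a lens space
when `l` is positive and this action is free. -/
def LensSpace (l m n : ℕ) : Type :=
  Quotient (@MulAction.orbitRel (rootsSubgroup l) S3 _ (rootsAction l m n))

namespace LensSpace

/-- The quotient map. -/
def mk (l m n : ℕ) (v : S3) : LensSpace l m n := Quotient.mk _ v

/-- The quotient topology. -/
instance (l m n : ℕ) : TopologicalSpace (LensSpace l m n) :=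
  inferInstanceAs (TopologicalSpace (Quotient _))

/-- The smooth real functions on `S³ / ℤ_l`: those whose pull-back to `S³` is smooth. -/
def smoothFunctions (l m n : ℕ) : Set (LensSpace l m n → ℝ) :=
  {f | ContMDiff (𝓡 3) 𝓘(ℝ, ℝ) ∞ (fun v : S3 => f (mk l m n v))}

end LensSpace

/-- The smooth functions on a subset `S` of a space `X` with smooth functions `A`: those that
locally extend to a smooth function on `X`. -/
def inducedSmooth {X : Type*} [TopologicalSpace X] (A : Set (X → ℝ)) (S : Set X) :
    Set (S → ℝ) :=
  {f | ∀ x : S, ∃ U : Set X, IsOpen U ∧ (x : X) ∈ U ∧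
    ∃ g ∈ A, ∀ y : S, (y : X) ∈ U → f y = g y}

/-- The smooth functions on a disjoint union: those that are smooth on each piece. -/
def sumSmooth {X Y : Type*} (A : Set (X → ℝ)) (B : Set (Y → ℝ)) : Set (X ⊕ Y → ℝ) :=
  {f | (fun x => f (Sum.inl x)) ∈ A ∧ (fun y => f (Sum.inr y)) ∈ B}

/-- A homeomorphism is a diffeomorphism, for the smooth structures given by the smooth functions
`A` and `B`, if it matches the smooth functions of the two sides. -/
def IsDiffeo {X Y : Type*} [TopologicalSpace X] [TopologicalSpace Y]
    (A : Set (X → ℝ)) (B : Set (Y → ℝ)) (e : X ≃ₜ Y) : Prop :=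
  ∀ f : Y → ℝ, f ∈ B ↔ (fun x => f (e x)) ∈ A

/-- `H` is a principal isotropy group of a `G`-space: an isotropy group of smallest type, that is,
one that is conjugate to a subgroup of every isotropy group. -/
def IsPrincipalIsotropy {G : Type*} [Group G] (X : Type*) [MulAction G X]
    (H : Subgroup G) : Prop :=
  (∃ x : X, H = MulAction.stabilizer G x) ∧
    ∀ y : X, ∃ g : G, ∀ h ∈ H, g * h * g⁻¹ ∈ MulAction.stabilizer G y

end

/-!
The isotropy group of `SU(2)` at `[(p, v)]` consists of the `p x ^ l p⁻¹` with `x` in the stabilizer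
of `v` under the weighted circle action. Elements of order dividing `gcd(n₁, n₂)` fix all of `S³`,
and nothing else fixes a vector with two nonzero coordinates, so a principal isotropy group `H` of
finite order `d ≥ 3` is a conjugate `p μ_d p⁻¹` of the group of `d`-th roots of unity, with
`d = gcd(n₁, n₂)`, and `l ≥ 1` (`IsPrincipalIsotropy.exists_mem_iff_conj`).

A point `[(p q, v)]` is fixed by `H` exactly if `q` conjugates `μ_d` into the circle. Because `μ_d`
contains a non-real number, this means that `q` lies in the normalizer `S¹ ∪ j S¹` of the circle
(`mk_mem_fixedPoints_iff`). The orbits of the two pieces have representatives `(p, v)` and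
`(p j, v)`, unique up to the action of the `l`-th roots of unity on `v`, and this gives a continuous
bijection from two copies of the lens space onto the fixed point set, which is a homeomorphism as its
source is compact and `N^l_{n₁, n₂}` is Hausdorff (`exists_homeomorph_fixedPoints`). It is a
diffeomorphism because an explicit formula with a cut-off function and a local choice of an `l`-th
root extends smooth functions from either piece by zero on the other (`exists_smooth_extension`,
`isDiffeo_fixedPoints`).

To recover `l` from the fixed point set, pass to a connected component. A homeomorphism between
`S³ / ℤ_l` and `S³ / ℤ_k` lifts, together with its inverse, to the coverings by `S³`, so it matches
fibres of `l` and of `k` elements (`LensSpace.le_of_homeomorph`). The fundamental group is not needed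
for this: a map from `S³` lifts through a covering since it lifts over the two punctured spheres
that are the domains of the stereographic projections from antipodal points, and their intersection
is connected (`IsCoveringMap.exists_lift_sphere`). An equivariant homeomorphism preserves isotropy
groups and fixed point sets, so it preserves `l` as well.
-/

noncomputable section

/-! ### Lifting maps defined on spheres -/

/-- Lifts exist over a space that is the union of two simply connected open sets with connected
intersection: a lift over one set and a lift over the other that agree at one common point agree on
the whole intersection, so they glue. -/
theorem IsCoveringMap.exists_lift_of_open_cover {S X E : Type*} [TopologicalSpace S]
    [TopologicalSpace X] [TopologicalSpace E] [LocallyPathConnectedSpace S] {p : E → X}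
    (hp : IsCoveringMap p) {U V : Set S} (hU : IsOpen U) (hV : IsOpen V)
    (hsU : SimplyConnectedSpace U) (hsV : SimplyConnectedSpace V) (hUV : U ∪ V = Set.univ)
    (hc : IsConnected (U ∩ V)) (f : C(S, X)) (s₀ : S) (e₀ : E) (he : p e₀ = f s₀) :
    ∃ F : C(S, E), F s₀ = e₀ ∧ p ∘ F = f := by
  classical
  wlog h₀ : s₀ ∈ U generalizing U V
  · refine this hV hU hsV hsU (by rwa [Set.union_comm]) (by rwa [Set.inter_comm]) ?_
    exact ((Set.mem_union _ _ _).1 (hUV ▸ Set.mem_univ s₀)).resolve_left h₀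
  have := hU.locallyPathConnectedSpace
  have := hV.locallyPathConnectedSpace
  obtain ⟨t, htU, htV⟩ := hc.nonempty
  obtain ⟨FU, ⟨hFU₀, hFU⟩, -⟩ := hp.existsUnique_continuousMap_lifts
    (f.comp ⟨Subtype.val, continuous_subtype_val⟩ : C(U, X)) ⟨s₀, h₀⟩ e₀ he
  obtain ⟨FV, ⟨hFV₀, hFV⟩, -⟩ := hp.existsUnique_continuousMap_lifts
    (f.comp ⟨Subtype.val, continuous_subtype_val⟩ : C(V, X)) ⟨t, htV⟩ (FU ⟨t, htU⟩)
    (congrFun hFU ⟨t, htU⟩)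
  have : PreconnectedSpace ↥(U ∩ V) := Subtype.preconnectedSpace hc.isPreconnected
  have hagree : (fun s : ↥(U ∩ V) => FU ⟨s, s.2.1⟩) = fun s : ↥(U ∩ V) => FV ⟨s, s.2.2⟩ := by
    refine hp.eq_of_comp_eq (by fun_prop) (by fun_prop) ?_ ⟨t, htU, htV⟩ hFV₀.symm
    funext s
    exact (congrFun hFU ⟨s, s.2.1⟩).trans (congrFun hFV ⟨s, s.2.2⟩).symm
  have hmem (s : S) (hs : s ∉ U) : s ∈ V :=
    ((Set.mem_union _ _ _).1 (hUV ▸ Set.mem_univ s)).resolve_left hs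
  let F (s : S) : E := if h : s ∈ U then FU ⟨s, h⟩ else FV ⟨s, hmem s h⟩
  have hFU' : U.domRestrict F = FU := by
    funext s
    simp [F]
  have hFV' : V.domRestrict F = FV := by
    funext s
    by_cases h : (s : S) ∈ U
    · simpa [F, h] using congrFun hagree ⟨s, h, s.2⟩
    · simp [F, h]
  have hF : Continuous F := by
    rw [← continuousOn_univ, ← hUV]
    refine ContinuousOn.union_of_isOpen ?_ ?_ hU hV
    · rw [continuousOn_iff_continuous_domRestrict, hFU']
      exact FU.continuous
    · rw [continuousOn_iff_continuous_domRestrict, hFV']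
      exact FV.continuous
  refine ⟨⟨F, hF⟩, ?_, ?_⟩
  · exact (congrFun hFU' ⟨s₀, h₀⟩).trans hFU₀
  · funext s
    by_cases h : s ∈ U
    · exact (congrArg p (congrFun hFU' ⟨s, h⟩)).trans (congrFun hFU ⟨s, h⟩)
    · exact (congrArg p (congrFun hFV' ⟨s, hmem s h⟩)).trans (congrFun hFV ⟨s, hmem s h⟩)

section Sphere

variable {V : Type*} [NormedAddCommGroup V] [InnerProductSpace ℝ V]

theorem simplyConnectedSpace_compl_singleton_sphere (v : Metric.sphere (0 : V) 1) :
    SimplyConnectedSpace ({v}ᶜ : Set (Metric.sphere (0 : V) 1)) := by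
  have hv : ‖(v : V)‖ = 1 := norm_eq_of_mem_sphere v
  have h := (isOpenEmbedding_stereographic_symm hv).toIsEmbedding.toHomeomorph
  rw [range_stereographic_symm hv v.2] at h
  have := h.symm.contractibleSpace
  infer_instance

theorem isConnected_compl_pair_sphere {n : ℕ} [Fact (Module.finrank ℝ V = n + 1)] (hn : 2 ≤ n)
    (v : Metric.sphere (0 : V) 1) :
    IsConnected ({v}ᶜ ∩ {-v}ᶜ : Set (Metric.sphere (0 : V) 1)) := by
  have hv : ‖(v : V)‖ = 1 := norm_eq_of_mem_sphere v
  -- the stereographic projection from `v` sends `-v` to `0`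
  have h : (stereographic hv).symm '' {0}ᶜ = {v}ᶜ ∩ {-v}ᶜ := by
    have h0 : (stereographic hv).symm 0 = -v := by
      rw [← stereographic_apply_neg v]
      exact (stereographic hv).left_inv (by simpa using (ne_neg_of_mem_unit_sphere ℝ v).symm)
    rw [Set.image_compl_eq_range_sdiff_image (isOpenEmbedding_stereographic_symm hv).injective,
      range_stereographic_symm hv v.2, Set.image_singleton, h0, Set.sdiff_eq]
  rw [← h]
  refine IsConnected.image ?_ _ (isOpenEmbedding_stereographic_symm hv).continuous.continuousOn
  refine isConnected_compl_singleton_of_one_lt_rank ?_ 0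
  have hfin := Submodule.finrank_orthogonal_span_singleton (𝕜 := ℝ) (n := n)
    (v := (v : V)) (by rintro h; simp [h] at hv)
  have : Module.Finite ℝ (ℝ ∙ (v : V))ᗮ := Module.finite_of_finrank_pos (by omega)
  rw [← Module.finrank_eq_rank, hfin]
  exact_mod_cast hn

/-- Maps from a sphere of dimension at least two lift through every covering map. -/
theorem IsCoveringMap.exists_lift_sphere {n : ℕ} [Fact (Module.finrank ℝ V = n + 1)] (hn : 2 ≤ n)
    {X E : Type*} [TopologicalSpace X] [TopologicalSpace E] {p : E → X} (hp : IsCoveringMap p)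
    (f : C(Metric.sphere (0 : V) 1, X)) (s₀ : Metric.sphere (0 : V) 1) (e₀ : E)
    (he : p e₀ = f s₀) : ∃ F : C(Metric.sphere (0 : V) 1, E), F s₀ = e₀ ∧ p ∘ F = f := by
  have : LocallyPathConnectedSpace (Metric.sphere (0 : V) 1) :=
    ChartedSpace.locallyPathConnectedSpace (EuclideanSpace ℝ (Fin n)) _
  refine hp.exists_lift_of_open_cover (U := {s₀}ᶜ) (V := {-s₀}ᶜ) isOpen_compl_singleton
    isOpen_compl_singleton (simplyConnectedSpace_compl_singleton_sphere _)
    (simplyConnectedSpace_compl_singleton_sphere _) ?_ (isConnected_compl_pair_sphere hn _)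
    f s₀ e₀ he
  have : s₀ ≠ -s₀ := ne_neg_of_mem_unit_sphere ℝ s₀
  rw [← Set.compl_inter, Set.singleton_inter_eq_empty.2 (by simpa using this), Set.compl_empty]

end Sphere

/-- A homeomorphism between the bases of two coverings by connected spaces in which all maps lift
embeds every fibre of the first covering into a fibre of the second. -/
theorem IsCoveringMap.exists_injective_fiber {E E' X X' : Type*} [TopologicalSpace E]
    [TopologicalSpace E'] [TopologicalSpace X] [TopologicalSpace X'] [PreconnectedSpace E]
    {p : E → X} {q : E' → X'} (hp : IsCoveringMap p) (hq : IsCoveringMap q)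
    (hq' : Function.Surjective q)
    (hE : ∀ (f : C(E, X')) (a : E) (b : E'), q b = f a → ∃ F : C(E, E'), F a = b ∧ q ∘ F = f)
    (hE' : ∀ (f : C(E', X)) (a : E') (b : E), p b = f a → ∃ F : C(E', E), F a = b ∧ p ∘ F = f)
    (h : X ≃ₜ X') (a : E) :
    ∃ (x' : X') (φ : p ⁻¹' {p a} → q ⁻¹' {x'}), Function.Injective φ := by
  obtain ⟨b, hb⟩ := hq' (h (p a))
  obtain ⟨F, hFa, hF⟩ := hE ⟨h ∘ p, h.continuous.comp hp.continuous⟩ a b hb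
  obtain ⟨G, hGb, hG⟩ := hE' ⟨h.symm ∘ q, h.symm.continuous.comp hq.continuous⟩ b a
    (by simp [hb])
  have hGF : G ∘ F = id := by
    refine hp.eq_of_comp_eq (G.continuous.comp F.continuous) continuous_id ?_ a
      (by simp [hFa, hGb])
    funext y
    have h1 := congrFun hG (F y)
    have h2 := congrFun hF y
    simp only [Function.comp_apply, ContinuousMap.coe_mk] at h1 h2
    simp [h1, h2]
  refine ⟨h (p a), fun y => ⟨F y, ?_⟩, fun y z hyz => Subtype.ext ?_⟩
  · have h2 := congrFun hF y
    have h3 : p y = p a := y.2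
    simpa [h3] using h2
  · have h1 := congrFun hGF y
    have h2 := congrFun hGF z
    simp only [Subtype.mk.injEq] at hyz
    simp only [Function.comp_apply, id, hyz] at h1 h2
    exact h1.symm.trans h2

theorem connectedComponent_inl {A B : Type*} [TopologicalSpace A] [TopologicalSpace B]
    [ConnectedSpace A] (a : A) :
    connectedComponent (Sum.inl a : A ⊕ B) = Set.range Sum.inl :=
  subset_antisymm (isClopen_range_inl.connectedComponent_subset ⟨a, rfl⟩)
    ((isPreconnected_range continuous_inl).subset_connectedComponent ⟨a, rfl⟩)

theorem connectedComponent_inr {A B : Type*} [TopologicalSpace A] [TopologicalSpace B]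
    [ConnectedSpace B] (b : B) :
    connectedComponent (Sum.inr b : A ⊕ B) = Set.range Sum.inr :=
  subset_antisymm (isClopen_range_inr.connectedComponent_subset ⟨b, rfl⟩)
    ((isPreconnected_range continuous_inr).subset_connectedComponent ⟨b, rfl⟩)

/-- If two copies of a connected space are homeomorphic to two copies of another, the two connected
spaces are homeomorphic, being the connected components. -/
theorem nonempty_homeomorph_of_sum_self {A B : Type*} [TopologicalSpace A] [TopologicalSpace B]
    [ConnectedSpace A] [ConnectedSpace B] (e : A ⊕ A ≃ₜ B ⊕ B) : Nonempty (A ≃ₜ B) := by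
  obtain ⟨a⟩ : Nonempty A := inferInstance
  have h : e '' Set.range Sum.inl = connectedComponent (e (Sum.inl a)) := by
    rw [← connectedComponent_inl a, ← connectedComponentIn_univ, ← connectedComponentIn_univ,
      e.image_connectedComponentIn (Set.mem_univ _), Set.image_univ, e.surjective.range_eq]
  have hA : A ≃ₜ Set.range (Sum.inl : A → A ⊕ A) := Topology.IsEmbedding.inl.toHomeomorph
  have hl : B ≃ₜ Set.range (Sum.inl : B → B ⊕ B) := Topology.IsEmbedding.inl.toHomeomorph
  have hr : B ≃ₜ Set.range (Sum.inr : B → B ⊕ B) := Topology.IsEmbedding.inr.toHomeomorph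
  have hAe := hA.trans (e.image _)
  rcases hb : e (Sum.inl a) with b | b
  · rw [hb, connectedComponent_inl] at h
    rw [h] at hAe
    exact ⟨hAe.trans hl.symm⟩
  · rw [hb, connectedComponent_inr] at h
    rw [h] at hAe
    exact ⟨hAe.trans hr.symm⟩

/-- A compact group acts properly on a Hausdorff space; in particular the orbit space is Hausdorff. -/
theorem properSMul_of_compactSpace {G X : Type*} [Group G] [TopologicalSpace G]
    [CompactSpace G] [TopologicalSpace X] [T2Space X] [MulAction G X] [ContinuousSMul G X] :
    ProperSMul G X :=
  ⟨isProperMap_of_comp_of_t2 (by fun_prop) continuous_snd isProperMap_snd_of_compactSpace⟩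

/-! ### The circle, its roots of unity and the weighted action on `S³` -/

theorem mem_rootsSubgroup {l : ℕ} {x : Circle} : x ∈ rootsSubgroup l ↔ x ^ l = 1 := Iff.rfl

theorem card_rootsSubgroup {l : ℕ} (hl : l ≠ 0) : Nat.card (rootsSubgroup l) = l := by
  have : NeZero l := ⟨hl⟩
  have e : rootsOfUnity l Circle ≃ rootsSubgroup l :=
    { toFun := fun u => ⟨(u : Circleˣ), by
        have h := congrArg Units.val ((mem_rootsOfUnity l (u : Circleˣ)).1 u.2)
        simpa [mem_rootsSubgroup] using h⟩
      invFun := fun x => ⟨toUnits (x : Circle), by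
        rw [mem_rootsOfUnity, ← map_pow, mem_rootsSubgroup.1 x.2, map_one]⟩
      left_inv := fun u => by ext; simp
      right_inv := fun x => by ext; simp }
  rw [← Nat.card_congr e, Nat.card_congr (rootsOfUnityCircleEquiv l).toEquiv,
    HasEnoughRootsOfUnity.natCard_rootsOfUnity]

theorem finite_rootsSubgroup {l : ℕ} (hl : l ≠ 0) : Finite (rootsSubgroup l) :=
  Nat.finite_of_card_ne_zero (by rwa [card_rootsSubgroup hl])

/-- An `l`-th root of `z / |z|` on the circle, for `l` and `z` nonzero. -/
def circleRoot (l : ℕ) (z : ℂ) : Circle := Circle.exp (Complex.arg z / l)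

theorem circleRoot_pow {l : ℕ} (hl : l ≠ 0) (z : ℂ) :
    circleRoot l z ^ l = Circle.exp (Complex.arg z) := by
  rw [circleRoot, ← Circle.exp_nsmul, nsmul_eq_mul, mul_div_cancel₀ _ (by exact_mod_cast hl)]

theorem circleRoot_coe_pow {l : ℕ} (hl : l ≠ 0) (x : Circle) : circleRoot l x ^ l = x := by
  rw [circleRoot_pow hl, Circle.exp_arg]

theorem exists_root_mem_rootsSubgroup {l d : ℕ} (hd : d ≠ 0) (h : l.Coprime d) {x : Circle}
    (hx : x ^ d = 1) : ∃ y : Circle, y ^ d = 1 ∧ y ^ l = x := by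
  have hc : (Nat.card (rootsSubgroup d)).Coprime l := by
    rw [card_rootsSubgroup hd]
    exact h.symm
  obtain ⟨y, hy⟩ := (powCoprime hc).surjective ⟨x, hx⟩
  exact ⟨y, y.2, congrArg Subtype.val hy⟩

theorem infinite_circle : Infinite Circle := by
  by_contra h
  rw [not_infinite_iff_finite] at h
  have hle := Nat.card_le_card_of_injective _ (Subtype.val_injective (p := (· ∈ rootsSubgroup
    (Nat.card Circle + 1))))
  have h2 := card_rootsSubgroup (l := Nat.card Circle + 1) (by omega)
  change Nat.card (rootsSubgroup _) ≤ _ at hle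
  omega

/-- `x · (z, w) = (x ^ m z, x ^ n w)`. -/
def weightedSMul (m n : ℕ) (x : Circle) (v : S3) : S3 := (weightedAction m n).smul x v

theorem weightedSMul_apply_zero (m n : ℕ) (x : Circle) (v : S3) :
    (weightedSMul m n x v).1 0 = (x : ℂ) ^ m * v.1 0 := rfl

theorem weightedSMul_apply_one (m n : ℕ) (x : Circle) (v : S3) :
    (weightedSMul m n x v).1 1 = (x : ℂ) ^ n * v.1 1 := rfl

theorem one_weightedSMul (m n : ℕ) (v : S3) : weightedSMul m n 1 v = v :=
  (weightedAction m n).one_smul v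

theorem mul_weightedSMul (m n : ℕ) (x y : Circle) (v : S3) :
    weightedSMul m n (x * y) v = weightedSMul m n x (weightedSMul m n y v) :=
  (weightedAction m n).mul_smul x y v

theorem weightedSMul_eq_self_iff {m n : ℕ} {x : Circle} {v : S3} :
    weightedSMul m n x v = v ↔ (v.1 0 = 0 ∨ x ^ m = 1) ∧ (v.1 1 = 0 ∨ x ^ n = 1) := by
  have h (k : ℕ) (z : ℂ) : (x : ℂ) ^ k * z = z ↔ z = 0 ∨ x ^ k = 1 := by
    rw [mul_left_eq_self₀, or_comm, ← Circle.coe_pow, Circle.coe_eq_one]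
  rw [← h, ← h, ← weightedSMul_apply_zero m n, ← weightedSMul_apply_one m n]
  refine ⟨fun hv => by rw [hv]; exact ⟨rfl, rfl⟩, fun hv => Subtype.ext ?_⟩
  ext i
  fin_cases i
  exacts [hv.1, hv.2]

theorem S3_ne_zero (v : S3) : v.1 0 ≠ 0 ∨ v.1 1 ≠ 0 := by
  by_contra! h
  refine ne_zero_of_mem_unit_sphere v ?_
  ext i
  fin_cases i
  exacts [h.1, h.2]

theorem weightedSMul_of_dvd {m n d : ℕ} (hm : d ∣ m) (hn : d ∣ n) {x : Circle} (hx : x ^ d = 1)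
    (v : S3) : weightedSMul m n x v = v := by
  obtain ⟨a, rfl⟩ := hm
  obtain ⟨b, rfl⟩ := hn
  simp [weightedSMul_eq_self_iff, pow_mul, hx]

/-- A point of `S³` at which the stabilizer for every weighted action is smallest. -/
def genericVector : S3 := ⟨!₂[3 / 5, 4 / 5], by
  rw [mem_sphere_zero_iff_norm, EuclideanSpace.norm_eq, Fin.sum_univ_two]
  norm_num⟩

theorem pow_gcd_eq_one_of_weightedSMul_genericVector {m n : ℕ} {x : Circle}
    (h : weightedSMul m n x genericVector = genericVector) : x ^ Nat.gcd m n = 1 := by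
  have h' := weightedSMul_eq_self_iff.1 h
  simp only [genericVector] at h'
  norm_num at h'
  exact pow_gcd_eq_one.2 ⟨h'.1, h'.2⟩

/-- The group of `l`-th roots of unity acts freely when both weights are prime to `l`. -/
theorem eq_one_of_weightedSMul_eq_self {l m n : ℕ} (hm : l.Coprime m) (hn : l.Coprime n)
    {x : Circle} (hx : x ^ l = 1) {v : S3} (hv : weightedSMul m n x v = v) : x = 1 := by
  have key (k : ℕ) (hk : l.Coprime k) (hxk : x ^ k = 1) : x = 1 := by
    simpa [hk.gcd_eq_one] using pow_gcd_eq_one.2 ⟨hx, hxk⟩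
  obtain ⟨h0, h1⟩ := weightedSMul_eq_self_iff.1 hv
  rcases S3_ne_zero v with h | h
  · exact key m hm (h0.resolve_left h)
  · exact key n hn (h1.resolve_left h)

theorem continuous_weightedSMul (m n : ℕ) :
    Continuous fun a : Circle × S3 => weightedSMul m n a.1 a.2 := by
  refine Continuous.subtype_mk ?_ _
  refine (PiLp.continuous_toLp 2 _).comp (continuous_pi fun i => ?_)
  fin_cases i
  · change Continuous fun a : Circle × S3 => (a.1 : ℂ) ^ m * a.2.1 0
    fun_prop
  · change Continuous fun a : Circle × S3 => (a.1 : ℂ) ^ n * a.2.1 1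
    fun_prop

/-! ### The normalizer of the circle in `SU(2)` -/

theorem circleToSU2_injective : Function.Injective circleToSU2 := by
  intro x y h
  have h' : Quaternion.ofComplex (x : ℂ) = Quaternion.ofComplex (y : ℂ) := congrArg Subtype.val h
  ext
  have hre := congrArg QuaternionAlgebra.re h'
  have him := congrArg QuaternionAlgebra.imI h'
  simp at hre him
  exact Complex.ext hre him

theorem continuous_circleToSU2 : Continuous circleToSU2 := by
  refine Continuous.subtype_mk ?_ _
  exact Quaternion.ofComplex.toLinearMap.continuous_of_finiteDimensional.comp
    continuous_subtype_val

theorem norm_quaternion_eq_one_iff (q : ℍ[ℝ]) :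
    ‖q‖ = 1 ↔ q.re ^ 2 + q.imI ^ 2 + q.imJ ^ 2 + q.imK ^ 2 = 1 := by
  rw [← Quaternion.normSq_def', Quaternion.normSq_eq_norm_mul_self, ← sq,
    pow_eq_one_iff_of_nonneg (norm_nonneg _) two_ne_zero]

/-- The unit quaternion `j`. -/
def quaternionJ : SU2 :=
  ⟨⟨0, 0, 1, 0⟩, mem_sphere_zero_iff_norm.2 ((norm_quaternion_eq_one_iff _).2 (by norm_num))⟩

@[simp] theorem re_quaternionJ : quaternionJ.1.re = 0 := rfl

@[simp] theorem imI_quaternionJ : quaternionJ.1.imI = 0 := rfl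

@[simp] theorem imJ_quaternionJ : quaternionJ.1.imJ = 1 := rfl

@[simp] theorem imK_quaternionJ : quaternionJ.1.imK = 0 := rfl

/-- The complex number `a` in the decomposition `q = a + j b` of a quaternion. -/
def firstCoord (q : SU2) : ℂ := ⟨q.1.re, q.1.imI⟩

theorem firstCoord_mul_circleToSU2 (q : SU2) (x : Circle) :
    firstCoord (q * circleToSU2 x) = firstCoord q * x := by
  apply Complex.ext <;> simp [firstCoord, circleToSU2]

theorem firstCoord_circleToSU2 (x : Circle) : firstCoord (circleToSU2 x) = x := by
  apply Complex.ext <;> simp [firstCoord, circleToSU2]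

theorem firstCoord_quaternionJ_mul_circleToSU2 (x : Circle) :
    firstCoord (quaternionJ * circleToSU2 x) = 0 := by
  apply Complex.ext <;> simp [firstCoord, circleToSU2]

theorem firstCoord_inv_quaternionJ : firstCoord quaternionJ⁻¹ = 0 := by
  have h : quaternionJ⁻¹ = quaternionJ * circleToSU2 (Circle.exp Real.pi) := by
    refine inv_eq_of_mul_eq_one_right ?_
    rw [← mul_assoc]
    apply Subtype.ext
    ext <;> simp [circleToSU2]
  rw [h, firstCoord_quaternionJ_mul_circleToSU2]

theorem circleToSU2_mul_quaternionJ (x : Circle) :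
    circleToSU2 x * quaternionJ = quaternionJ * circleToSU2 x⁻¹ := by
  apply Subtype.ext
  ext <;> simp [circleToSU2]

/-- A unit quaternion that conjugates a non-real point of the circle into the circle lies in the
normalizer of the circle, which is the union of the circle and its translate by `j`. -/
theorem exists_eq_circleToSU2_of_mul_eq_mul {x z : Circle} (hx : (x : ℂ).im ≠ 0) {q : SU2}
    (h : circleToSU2 x * q = q * circleToSU2 z) :
    (∃ y, q = circleToSU2 y) ∨ ∃ y, q = quaternionJ * circleToSU2 y := by
  have hn : q.1.re ^ 2 + q.1.imI ^ 2 + q.1.imJ ^ 2 + q.1.imK ^ 2 = 1 :=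
    (norm_quaternion_eq_one_iff _).1 (norm_eq_of_mem_sphere q)
  have h' : Quaternion.ofComplex (x : ℂ) * q.1 = q.1 * Quaternion.ofComplex (z : ℂ) :=
    congrArg Subtype.val h
  set a : ℂ := ⟨q.1.re, q.1.imI⟩ with ha
  set b : ℂ := ⟨q.1.imJ, -q.1.imK⟩ with hb
  have e0 := congrArg QuaternionAlgebra.re h'
  have e1 := congrArg QuaternionAlgebra.imI h'
  have e2 := congrArg QuaternionAlgebra.imJ h'
  have e3 := congrArg QuaternionAlgebra.imK h'
  simp at e0 e1 e2 e3
  have hA : a * x = a * z := by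
    apply Complex.ext <;> simp [ha] <;> linarith
  have hB : b * (starRingEnd ℂ) x = b * z := by
    apply Complex.ext <;> simp [hb] <;> linarith
  have mk_circle (w : ℂ) (hw : w.re ^ 2 + w.im ^ 2 = 1) : ∃ y : Circle, (y : ℂ) = w := by
    refine ⟨⟨w, ?_⟩, rfl⟩
    refine mem_sphere_zero_iff_norm.2 ?_
    rw [← pow_eq_one_iff_of_nonneg (norm_nonneg _) two_ne_zero, Complex.sq_norm, Complex.normSq_apply]
    linarith
  by_cases ha0 : a = 0
  · right
    have h0 : q.1.re = 0 := congrArg Complex.re ha0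
    have h1 : q.1.imI = 0 := congrArg Complex.im ha0
    obtain ⟨y, hy⟩ := mk_circle b (by simp [hb]; nlinarith)
    refine ⟨y, Subtype.ext ?_⟩
    ext <;> simp [circleToSU2, hy, h0, h1, hb]
  · left
    have hxz := mul_left_cancel₀ ha0 hA
    have hb0 : b = 0 := by
      by_contra hb0
      have := congrArg Complex.im ((mul_left_cancel₀ hb0 hB).trans hxz.symm)
      simp at this
      exact hx (by linarith)
    have h2 : q.1.imJ = 0 := congrArg Complex.re hb0
    have h3 : -q.1.imK = 0 := congrArg Complex.im hb0
    obtain ⟨y, hy⟩ := mk_circle a (by simp [ha]; nlinarith)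
    refine ⟨y, Subtype.ext ?_⟩
    ext <;> simp [circleToSU2, hy, ha, h2, neg_eq_zero.1 h3]

/-! ### Isotropy groups -/

theorem NSpace.mk_eq_mk_iff {l m n : ℕ} {p q : SU2} {v w : S3} :
    NSpace.mk l m n (p, v) = NSpace.mk l m n (q, w) ↔
      ∃ x : Circle, p = q * circleToSU2 x ^ l ∧ v = weightedSMul m n x w := by
  refine Quotient.eq''.trans ⟨?_, ?_⟩
  · rintro ⟨x, hx⟩
    exact ⟨x, (congrArg Prod.fst hx).symm, (congrArg Prod.snd hx).symm⟩
  · rintro ⟨x, h, h'⟩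
    exact ⟨x, Prod.ext h.symm h'.symm⟩

theorem NSpace.smul_mk (l m n : ℕ) (g p : SU2) (v : S3) :
    g • NSpace.mk l m n (p, v) = NSpace.mk l m n (g * p, v) := rfl

theorem NSpace.exists_mk_eq {l m n : ℕ} (x : NSpace l m n) : ∃ p v, NSpace.mk l m n (p, v) = x := by
  obtain ⟨⟨p, v⟩, h⟩ := Quotient.exists_rep x
  exact ⟨p, v, h⟩

theorem NSpace.mem_stabilizer_mk_iff {l m n : ℕ} {g p : SU2} {v : S3} :
    g ∈ MulAction.stabilizer SU2 (NSpace.mk l m n (p, v)) ↔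
      ∃ x : Circle, weightedSMul m n x v = v ∧ g = p * circleToSU2 x ^ l * p⁻¹ := by
  rw [MulAction.mem_stabilizer_iff, NSpace.smul_mk, NSpace.mk_eq_mk_iff]
  refine exists_congr fun x => ?_
  rw [eq_mul_inv_iff_mul_eq, and_comm, eq_comm (a := v)]

/-- A principal isotropy group of finite order `d ≥ 3` is conjugate to the group of `d`-th roots of
unity, with `d = gcd(n₁, n₂)`: it contains a conjugate of the `gcd(n₁, n₂)`-th roots of unity,
because these fix `S³` pointwise, and comparison with the isotropy group at a generic point shows
that it is not larger. -/
theorem IsPrincipalIsotropy.exists_mem_iff_conj {n₁ n₂ l d : ℕ} (h₁ : Nat.Coprime l n₁)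
    (h₂ : Nat.Coprime l n₂) (hd : 3 ≤ d) {H : Subgroup SU2}
    (hH : IsPrincipalIsotropy (NSpace l n₁ n₂) H)
    (hHd : Nonempty (H ≃* Multiplicative (ZMod d))) :
    l ≠ 0 ∧ l.Coprime d ∧ d ∣ n₁ ∧ d ∣ n₂ ∧
      ∃ p : SU2, ∀ h, h ∈ H ↔ ∃ x : Circle, x ^ d = 1 ∧ h = p * circleToSU2 x * p⁻¹ := by
  have : NeZero d := ⟨by omega⟩
  obtain ⟨f⟩ := hHd
  have hcard : Nat.card H = d := by
    rw [Nat.card_congr f.toEquiv, Nat.card_congr Multiplicative.toAdd, Nat.card_zmod]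
  have hfin : Finite H := Nat.finite_of_card_ne_zero (by omega)
  obtain ⟨⟨y, hy⟩, hH⟩ := hH
  obtain ⟨p, v, rfl⟩ := y.exists_mk_eq
  have hsub (x : Circle) (hx : x ^ Nat.gcd n₁ n₂ = 1) : p * circleToSU2 (x ^ l) * p⁻¹ ∈ H := by
    rw [hy, NSpace.mem_stabilizer_mk_iff]
    exact ⟨x, weightedSMul_of_dvd (Nat.gcd_dvd_left _ _) (Nat.gcd_dvd_right _ _) hx v,
      by rw [map_pow]⟩
  have hconj : Function.Injective fun x : Circle => p * circleToSU2 x * p⁻¹ := by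
    intro x y hxy
    exact circleToSU2_injective (mul_left_cancel (mul_right_cancel hxy))
  have hD : Nat.gcd n₁ n₂ ≠ 0 := by
    intro h0
    obtain ⟨rfl, rfl⟩ := Nat.gcd_eq_zero_iff.1 h0
    obtain rfl : l = 1 := by simpa using h₁
    have := infinite_circle
    refine not_injective_infinite_finite (fun x : Circle =>
      (⟨p * circleToSU2 x * p⁻¹, by simpa using hsub x (by simp)⟩ : H)) fun x y hxy => ?_
    exact hconj (congrArg Subtype.val hxy)
  have hlD : l.Coprime (Nat.gcd n₁ n₂) := h₁.coprime_dvd_right (Nat.gcd_dvd_left _ _)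
  have := finite_rootsSubgroup hD
  have hle : d ≤ Nat.gcd n₁ n₂ := by
    obtain ⟨g, hg⟩ := hH (NSpace.mk l n₁ n₂ (1, genericVector))
    have hg' (h : H) : ∃ x : rootsSubgroup (Nat.gcd n₁ n₂),
        g * h * g⁻¹ = circleToSU2 x := by
      obtain ⟨x, hx, hgx⟩ := NSpace.mem_stabilizer_mk_iff.1 (hg h h.2)
      refine ⟨⟨x, pow_gcd_eq_one_of_weightedSMul_genericVector hx⟩ ^ l, ?_⟩
      simpa using hgx
    choose φ hφ using hg'
    have hinj : Function.Injective φ := by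
      intro h h' e
      have := (hφ h).trans ((congrArg (fun x : rootsSubgroup _ => circleToSU2 x) e).trans
        (hφ h').symm)
      exact Subtype.ext (mul_left_cancel (mul_right_cancel this))
    have := Nat.card_le_card_of_injective φ hinj
    rwa [hcard, card_rootsSubgroup hD] at this
  have hsub' (x : Circle) (hx : x ^ Nat.gcd n₁ n₂ = 1) : p * circleToSU2 x * p⁻¹ ∈ H := by
    obtain ⟨y, hy, rfl⟩ := exists_root_mem_rootsSubgroup hD hlD hx
    exact hsub y hy
  let ψ (x : rootsSubgroup (Nat.gcd n₁ n₂)) : H := ⟨p * circleToSU2 x * p⁻¹, hsub' x x.2⟩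
  have hψ : Function.Injective ψ := fun x y hxy =>
    Subtype.ext (hconj (congrArg Subtype.val hxy))
  have hψ' := (Nat.bijective_iff_injective_and_card ψ).2 ⟨hψ, by
    have := Nat.card_le_card_of_injective ψ hψ
    rw [hcard, card_rootsSubgroup hD] at *
    omega⟩
  obtain rfl : d = Nat.gcd n₁ n₂ := by
    rw [← hcard, ← Nat.card_congr (Equiv.ofBijective ψ hψ'), card_rootsSubgroup hD]
  refine ⟨?_, hlD, Nat.gcd_dvd_left _ _, Nat.gcd_dvd_right _ _, p, fun h => ⟨fun hh => ?_, ?_⟩⟩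
  · rintro rfl
    simp at h₁ h₂
    simp [h₁, h₂] at hd
  · obtain ⟨x, hx⟩ := hψ'.2 ⟨h, hh⟩
    exact ⟨x, x.2, (congrArg Subtype.val hx).symm⟩
  · rintro ⟨x, hx, rfl⟩
    exact hsub' x hx

/-! ### The fixed point set as two copies of the lens space -/

theorem exists_root_of_unity_im_ne_zero {d : ℕ} (hd : 3 ≤ d) :
    ∃ x : Circle, x ^ d = 1 ∧ (x : ℂ).im ≠ 0 := by
  have hd' : (3 : ℝ) ≤ d := by exact_mod_cast hd
  refine ⟨Circle.exp (2 * Real.pi / d), ?_, ?_⟩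
  · rw [← Circle.exp_nsmul, nsmul_eq_mul, mul_div_cancel₀ _ (by positivity), Circle.exp_two_pi]
  · rw [Circle.coe_exp, Complex.exp_ofReal_mul_I_im]
    refine (Real.sin_pos_of_pos_of_lt_pi (by positivity) ?_).ne'
    rw [div_lt_iff₀ (by positivity)]
    nlinarith [Real.pi_pos]

/-- The fixed points of a conjugate by `p` of the `d`-th roots of unity are the points `[(p q, v)]`
with `q` in the normalizer of the circle. For `d ≥ 3` there is a non-real `d`-th root of unity, so
no other `q` conjugates the `d`-th roots of unity into the circle. -/
theorem mk_mem_fixedPoints_iff {l m n d : ℕ} (hd : 3 ≤ d) (hld : l.Coprime d) (hm : d ∣ m)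
    (hn : d ∣ n) {H : Subgroup SU2} {p : SU2}
    (hH : ∀ h, h ∈ H ↔ ∃ x : Circle, x ^ d = 1 ∧ h = p * circleToSU2 x * p⁻¹) {q : SU2} {v : S3} :
    NSpace.mk l m n (p * q, v) ∈ MulAction.fixedPoints H (NSpace l m n) ↔
      (∃ y, q = circleToSU2 y) ∨ ∃ y, q = quaternionJ * circleToSU2 y := by
  have hroot (r : SU2) {x : Circle} (hx : x ^ d = 1) :
      NSpace.mk l m n (r * circleToSU2 x, v) = NSpace.mk l m n (r, v) := by
    obtain ⟨y, hy, rfl⟩ := exists_root_mem_rootsSubgroup (by omega) hld hx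
    exact NSpace.mk_eq_mk_iff.2 ⟨y, by rw [map_pow], (weightedSMul_of_dvd hm hn hy v).symm⟩
  constructor
  · intro h
    obtain ⟨x, hx, hx'⟩ := exists_root_of_unity_im_ne_zero hd
    have h1 : (p * circleToSU2 x * p⁻¹) • NSpace.mk l m n (p * q, v) = NSpace.mk l m n (p * q, v) :=
      h ⟨_, (hH _).2 ⟨x, hx, rfl⟩⟩
    obtain ⟨y, hy, -⟩ := NSpace.mk_eq_mk_iff.1 h1
    refine exists_eq_circleToSU2_of_mul_eq_mul (z := y ^ l) hx' ?_
    rw [map_pow]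
    refine mul_left_cancel (a := p) ?_
    simpa [mul_assoc] using hy
  · rintro h ⟨g, hg⟩
    obtain ⟨x, hx, rfl⟩ := (hH g).1 hg
    change (p * circleToSU2 x * p⁻¹) • NSpace.mk l m n (p * q, v) = _
    rw [NSpace.smul_mk]
    rcases h with ⟨y, rfl⟩ | ⟨y, rfl⟩
    · rw [show p * circleToSU2 x * p⁻¹ * (p * circleToSU2 y) =
        p * circleToSU2 y * circleToSU2 x by
          simp [mul_assoc, ← map_mul, mul_comm x y], hroot _ hx]
    · rw [show p * circleToSU2 x * p⁻¹ * (p * (quaternionJ * circleToSU2 y)) =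
        p * (quaternionJ * circleToSU2 y) * circleToSU2 x⁻¹ by
          simp only [mul_assoc, inv_mul_cancel_left]
          rw [← mul_assoc (circleToSU2 x), circleToSU2_mul_quaternionJ, mul_assoc, ← map_mul,
            ← map_mul, mul_comm], hroot _ (by simp [hx])]

theorem LensSpace.mk_eq_mk_iff {l m n : ℕ} {v w : S3} :
    LensSpace.mk l m n v = LensSpace.mk l m n w ↔
      ∃ x : Circle, x ^ l = 1 ∧ v = weightedSMul m n x w := by
  refine Quotient.eq''.trans ⟨?_, ?_⟩
  · rintro ⟨x, hx⟩
    exact ⟨x, x.2, hx.symm⟩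
  · rintro ⟨x, hx, rfl⟩
    exact ⟨⟨x, hx⟩, rfl⟩

/-- The map `[v] ↦ [(p, v)]` from the lens space to `N^l_{m,n}`. -/
def lensToNSpace (l m n : ℕ) (p : SU2) : LensSpace l m n → NSpace l m n :=
  Quotient.lift (fun v => NSpace.mk l m n (p, v)) fun v w h => by
    obtain ⟨x, hx, hv⟩ := LensSpace.mk_eq_mk_iff.1 (Quotient.sound h)
    exact NSpace.mk_eq_mk_iff.2 ⟨x, by rw [← map_pow, hx, map_one, mul_one], hv⟩

theorem lensToNSpace_mk (l m n : ℕ) (p : SU2) (v : S3) :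
    lensToNSpace l m n p (LensSpace.mk l m n v) = NSpace.mk l m n (p, v) := rfl

theorem NSpace.continuous_mk (l m n : ℕ) : Continuous (NSpace.mk l m n) :=
  continuous_quotient_mk'

theorem continuous_lensToNSpace (l m n : ℕ) (p : SU2) : Continuous (lensToNSpace l m n p) :=
  ((NSpace.continuous_mk l m n).comp (by fun_prop)).quotient_lift _

theorem LensSpace.exists_mk_eq {l m n : ℕ} (x : LensSpace l m n) : ∃ v, LensSpace.mk l m n v = x :=
  Quotient.exists_rep x

theorem lensToNSpace_injective (l m n : ℕ) (p : SU2) :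
    Function.Injective (lensToNSpace l m n p) := by
  intro a b h
  obtain ⟨v, rfl⟩ := a.exists_mk_eq
  obtain ⟨w, rfl⟩ := b.exists_mk_eq
  obtain ⟨x, hx, hv⟩ := NSpace.mk_eq_mk_iff.1 h
  refine LensSpace.mk_eq_mk_iff.2 ⟨x, circleToSU2_injective ?_, hv⟩
  rw [map_pow, map_one]
  exact mul_eq_left.1 hx.symm

theorem lensToNSpace_ne (l m n : ℕ) (p : SU2) (a b : LensSpace l m n) :
    lensToNSpace l m n p a ≠ lensToNSpace l m n (p * quaternionJ) b := by
  obtain ⟨v, rfl⟩ := a.exists_mk_eq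
  obtain ⟨w, rfl⟩ := b.exists_mk_eq
  intro h
  obtain ⟨x, hx, -⟩ := NSpace.mk_eq_mk_iff.1 h
  rw [← map_pow, mul_assoc] at hx
  have h0 := congrArg firstCoord (mul_eq_left.1 hx.symm)
  rw [firstCoord_quaternionJ_mul_circleToSU2, ← map_one circleToSU2, firstCoord_circleToSU2] at h0
  simp at h0

/-- Since every element of the circle has an `l`-th root, each orbit through `(p y, v)` with `y` in
the circle contains a point `(p, w)`. -/
theorem NSpace.exists_mk_mul_circleToSU2 {l : ℕ} (hl : l ≠ 0) (m n : ℕ) (p : SU2) (y : Circle)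
    (v : S3) : ∃ w, NSpace.mk l m n (p * circleToSU2 y, v) = NSpace.mk l m n (p, w) := by
  refine ⟨weightedSMul m n (circleRoot l y)⁻¹ v, NSpace.mk_eq_mk_iff.2 ⟨circleRoot l y, ?_, ?_⟩⟩
  · rw [← map_pow, circleRoot_coe_pow hl]
  · rw [← mul_weightedSMul, mul_inv_cancel, one_weightedSMul]

instance (l m n : ℕ) : T2Space (NSpace l m n) := by
  let := circleAction l m n
  have : ContinuousSMul Circle (SU2 × S3) := ⟨by
    change Continuous fun a : Circle × SU2 × S3 =>
      (a.2.1 * circleToSU2 a.1 ^ l, weightedSMul m n a.1 a.2.2)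
    have h1 := continuous_circleToSU2
    have h2 := continuous_weightedSMul m n
    exact Continuous.prodMk (by fun_prop)
      (h2.comp (g := fun a : Circle × S3 => weightedSMul m n a.1 a.2)
        (f := fun a : Circle × SU2 × S3 => (a.1, a.2.2)) (by fun_prop))⟩
  have : ProperSMul Circle (SU2 × S3) := properSMul_of_compactSpace
  exact inferInstanceAs (T2Space (Quotient (MulAction.orbitRel Circle (SU2 × S3))))

instance (l m n : ℕ) : CompactSpace (LensSpace l m n) :=
  inferInstanceAs (CompactSpace (Quotient _))

instance (l m n : ℕ) : ConnectedSpace (LensSpace l m n) := by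
  have : ConnectedSpace S3 := by
    rw [← isConnected_iff_connectedSpace]
    refine isConnected_sphere ?_ 0 zero_le_one
    rw [← Module.finrank_eq_rank, finrank_complexPlane_fact.out]
    norm_num
  exact inferInstanceAs (ConnectedSpace (Quotient _))

/-- The fixed point set of a conjugate by `p` of the `d`-th roots of unity is the disjoint union of
the lens spaces `{[(p, v)]}` and `{[(p j, v)]}`. -/
theorem exists_homeomorph_fixedPoints {l m n d : ℕ} (hl : l ≠ 0) (hd : 3 ≤ d) (hld : l.Coprime d)
    (hm : d ∣ m) (hn : d ∣ n) {H : Subgroup SU2} {p : SU2}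
    (hH : ∀ h, h ∈ H ↔ ∃ x : Circle, x ^ d = 1 ∧ h = p * circleToSU2 x * p⁻¹) :
    ∃ e : LensSpace l m n ⊕ LensSpace l m n ≃ₜ MulAction.fixedPoints H (NSpace l m n),
      (∀ a, (e (Sum.inl a) : NSpace l m n) = lensToNSpace l m n p a) ∧
      ∀ a, (e (Sum.inr a) : NSpace l m n) = lensToNSpace l m n (p * quaternionJ) a := by
  have hfix {q : SU2} {v : S3} := mk_mem_fixedPoints_iff hd hld hm hn hH (q := q) (v := v)
  let φ : LensSpace l m n ⊕ LensSpace l m n → MulAction.fixedPoints H (NSpace l m n) :=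
    Sum.elim
      (fun a => ⟨lensToNSpace l m n p a, by
        obtain ⟨v, rfl⟩ := a.exists_mk_eq
        rw [lensToNSpace_mk, ← mul_one p, hfix]
        exact Or.inl ⟨1, (map_one _).symm⟩⟩)
      (fun a => ⟨lensToNSpace l m n (p * quaternionJ) a, by
        obtain ⟨v, rfl⟩ := a.exists_mk_eq
        rw [lensToNSpace_mk, hfix]
        exact Or.inr ⟨1, by rw [map_one, mul_one]⟩⟩)
  have hcont : Continuous φ :=
    Continuous.sumElim ((continuous_lensToNSpace l m n _).subtype_mk _)
      ((continuous_lensToNSpace l m n _).subtype_mk _)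
  have hinj : Function.Injective φ := by
    rintro (a | a) (b | b) h
    · exact congrArg _ (lensToNSpace_injective l m n _ (congrArg Subtype.val h))
    · exact (lensToNSpace_ne l m n p a b (congrArg Subtype.val h)).elim
    · exact (lensToNSpace_ne l m n p b a (congrArg Subtype.val h).symm).elim
    · exact congrArg _ (lensToNSpace_injective l m n _ (congrArg Subtype.val h))
  have hsurj : Function.Surjective φ := by
    rintro ⟨x, hx⟩
    obtain ⟨q, v, rfl⟩ := x.exists_mk_eq
    obtain ⟨q, rfl⟩ : ∃ r, q = p * r := ⟨p⁻¹ * q, by simp⟩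
    rcases hfix.1 hx with ⟨y, rfl⟩ | ⟨y, rfl⟩
    · obtain ⟨w, hw⟩ := NSpace.exists_mk_mul_circleToSU2 hl m n p y v
      exact ⟨Sum.inl (LensSpace.mk l m n w), Subtype.ext hw.symm⟩
    · obtain ⟨w, hw⟩ := NSpace.exists_mk_mul_circleToSU2 hl m n (p * quaternionJ) y v
      refine ⟨Sum.inr (LensSpace.mk l m n w), Subtype.ext ?_⟩
      rw [mul_assoc] at hw
      exact hw.symm
  exact ⟨hcont.homeoOfEquivCompactToT2 (f := Equiv.ofBijective φ ⟨hinj, hsurj⟩), fun _ => rfl, fun _ => rfl⟩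

/-! ### Smooth functions on the fixed point set -/

theorem coe_exp_arg {z : ℂ} (hz : z ≠ 0) : (Circle.exp z.arg : ℂ) = z / ‖z‖ := by
  have h : (‖z‖ : ℂ) ≠ 0 := by simpa using hz
  rw [eq_div_iff h, Circle.coe_exp, mul_comm, Complex.norm_mul_exp_arg_mul_I]

theorem exp_arg_mul {z w : ℂ} (hz : z ≠ 0) (hw : w ≠ 0) :
    Circle.exp (z * w).arg = Circle.exp z.arg * Circle.exp w.arg := by
  ext
  rw [Circle.coe_mul, coe_exp_arg hz, coe_exp_arg hw, coe_exp_arg (mul_ne_zero hz hw), norm_mul,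
    Complex.ofReal_mul, div_mul_div_comm]

theorem LensSpace.mk_inv_weightedSMul_eq {l m n : ℕ} {x y : Circle} (h : x ^ l = y ^ l) (v : S3) :
    LensSpace.mk l m n (weightedSMul m n x⁻¹ v) = LensSpace.mk l m n (weightedSMul m n y⁻¹ v) := by
  refine LensSpace.mk_eq_mk_iff.2 ⟨x⁻¹ * y, ?_, ?_⟩
  · rw [mul_pow, inv_pow, h, inv_mul_cancel]
  · rw [← mul_weightedSMul, mul_assoc, mul_inv_cancel, mul_one]

theorem contMDiff_weightedSMul_exp (m n : ℕ) :
    ContMDiff (𝓘(ℝ, ℝ).prod (𝓡 3)) (𝓡 3) ∞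
      fun a : ℝ × S3 => weightedSMul m n (Circle.exp a.1) a.2 := by
  have h : ContDiff ℝ ∞ fun a : ℝ × EuclideanSpace ℂ (Fin 2) =>
      (!₂[Complex.exp (a.1 * Complex.I) ^ m * a.2 0,
        Complex.exp (a.1 * Complex.I) ^ n * a.2 1] : EuclideanSpace ℂ (Fin 2)) := by
    have hexp : ContDiff ℝ ∞ fun a : ℝ × EuclideanSpace ℂ (Fin 2) =>
        Complex.exp (a.1 * Complex.I) :=
      ((Complex.ofRealCLM.contDiff.comp contDiff_fst).mul contDiff_const).cexp
    have hproj (i : Fin 2) : ContDiff ℝ ∞ fun a : ℝ × EuclideanSpace ℂ (Fin 2) => a.2 i :=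
      ((EuclideanSpace.proj (𝕜 := ℂ) i).restrictScalars ℝ).contDiff.comp contDiff_snd
    refine (contDiff_piLp 2).2 fun i => ?_
    fin_cases i
    · exact (hexp.pow m).mul (hproj 0)
    · exact (hexp.pow n).mul (hproj 1)
  have hc : ContMDiff (𝓘(ℝ, ℝ).prod (𝓡 3)) 𝓘(ℝ, ℝ × EuclideanSpace ℂ (Fin 2)) ∞
      fun a : ℝ × S3 => ((a.1, a.2.1) : ℝ × EuclideanSpace ℂ (Fin 2)) :=
    contMDiff_fst.prodMk_space (contMDiff_coe_sphere.comp contMDiff_snd)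
  exact (h.contMDiff.comp hc).codRestrict_sphere fun a =>
    (weightedSMul m n (Circle.exp a.1) a.2).2

theorem contMDiff_firstCoord : ContMDiff (𝓡 3) 𝓘(ℝ, ℂ) ∞ firstCoord := by
  let L : ℍ[ℝ] →ₗ[ℝ] ℂ :=
    { toFun := fun q => ⟨q.re, q.imI⟩
      map_add' := fun p q => by apply Complex.ext <;> simp
      map_smul' := fun c q => by apply Complex.ext <;> simp }
  exact (LinearMap.toContinuousLinearMap L).contDiff.contMDiff.comp contMDiff_coe_sphere

theorem NSpace.smul_mem_smoothFunctions {l m n : ℕ} {g : NSpace l m n → ℝ}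
    (hg : g ∈ NSpace.smoothFunctions l m n) (p : SU2) :
    (fun x => g (p • x)) ∈ NSpace.smoothFunctions l m n := by
  have hp : ContMDiff (𝓡 3) (𝓡 3) ∞ fun q : SU2 => p * q := by
    have h : ContDiff ℝ ∞ fun q : ℍ[ℝ] => p.1 * q := contDiff_const.mul contDiff_id
    exact (h.contMDiff.comp contMDiff_coe_sphere).codRestrict_sphere fun q => (p * q).2
  exact ContMDiff.comp (g := fun a : SU2 × S3 => g (NSpace.mk l m n a)) hg ((hp.comp contMDiff_fst).prodMk contMDiff_snd)

theorem LensSpace.contMDiffAt_comp_weightedSMul_exp {l m n : ℕ} {F : LensSpace l m n → ℝ}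
    (hF : F ∈ LensSpace.smoothFunctions l m n) {θ : SU2 × S3 → ℝ} {a₀ : SU2 × S3}
    (hθ : ContMDiffAt ((𝓡 3).prod (𝓡 3)) 𝓘(ℝ, ℝ) ∞ θ a₀) :
    ContMDiffAt ((𝓡 3).prod (𝓡 3)) 𝓘(ℝ, ℝ) ∞
      (fun a => F (LensSpace.mk l m n (weightedSMul m n (Circle.exp (θ a)) a.2))) a₀ := by
  have hF' : ContMDiff (𝓡 3) 𝓘(ℝ, ℝ) ∞ fun v : S3 => F (LensSpace.mk l m n v) := hF
  have hg := (hF'.comp (contMDiff_weightedSMul_exp m n)).contMDiffAt (x := (θ a₀, a₀.2))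
  have hpair : ContMDiffAt ((𝓡 3).prod (𝓡 3)) (𝓘(ℝ, ℝ).prod (𝓡 3)) ∞
      (fun a : SU2 × S3 => (θ a, a.2)) a₀ := hθ.prodMk contMDiffAt_snd
  have h := hg.comp (f := fun a : SU2 × S3 => (θ a, a.2)) a₀ hpair
  exact h

/-- A smooth function on the lens space `{[(1, v)]}` extends to a smooth function on `N^l_{m,n}`
that vanishes where the first coordinate of the quaternion does. With `q = a + j b`, the extension
is `[(q, v)] ↦ χ(|a|²) F(r⁻¹ v)`, where `r ^ l = a / |a|` and `χ` is a cut-off function; different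
choices of `r` give the same value because `F` is invariant under `l`-th roots of unity. -/
theorem exists_smooth_extension {l : ℕ} (hl : l ≠ 0) {m n : ℕ} {F : LensSpace l m n → ℝ}
    (hF : F ∈ LensSpace.smoothFunctions l m n) :
    ∃ g ∈ NSpace.smoothFunctions l m n, (∀ a, g (lensToNSpace l m n 1 a) = F a) ∧
      ∀ q v, firstCoord q = 0 → g (NSpace.mk l m n (q, v)) = 0 := by
  let χ (z : ℂ) : ℝ := Real.smoothTransition (2 * ‖z‖ ^ 2 - 1)
  have hχ0 : χ 0 = 0 := Real.smoothTransition.zero_of_nonpos (by norm_num)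
  have hχ : ContDiff ℝ ∞ χ := Real.smoothTransition.contDiff.comp
    ((contDiff_const.mul (contDiff_norm_sq ℝ)).sub contDiff_const)
  let G (a : SU2 × S3) : ℝ := χ (firstCoord a.1) *
    F (LensSpace.mk l m n (weightedSMul m n (circleRoot l (firstCoord a.1))⁻¹ a.2))
  have hG (a b : SU2 × S3) (h : NSpace.mk l m n a = NSpace.mk l m n b) : G a = G b := by
    obtain ⟨p, v⟩ := a
    obtain ⟨q, w⟩ := b
    obtain ⟨x, rfl, rfl⟩ := NSpace.mk_eq_mk_iff.1 h
    simp only [G]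
    rw [← map_pow, firstCoord_mul_circleToSU2]
    by_cases hq : firstCoord q = 0
    · simp [hq, hχ0]
    · have hroot : circleRoot l (firstCoord q * ↑(x ^ l)) ^ l =
          (circleRoot l (firstCoord q) * x) ^ l := by
        rw [mul_pow, circleRoot_pow hl, circleRoot_pow hl, exp_arg_mul hq (Circle.coe_ne_zero _),
          Circle.exp_arg]
      rw [LensSpace.mk_inv_weightedSMul_eq hroot, ← mul_weightedSMul, mul_inv, mul_assoc,
        inv_mul_cancel, mul_one]
      simp only [χ, norm_mul, Circle.norm_coe, mul_one]
  refine ⟨Quotient.lift G fun a b h => hG a b (Quotient.sound h), ?_, ?_, ?_⟩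
  · change ContMDiff _ _ _ G
    rintro ⟨q₀, v₀⟩
    have hfc : ContMDiff ((𝓡 3).prod (𝓡 3)) 𝓘(ℝ, ℂ) ∞ fun a : SU2 × S3 => firstCoord a.1 :=
      contMDiff_firstCoord.comp contMDiff_fst
    by_cases h0 : firstCoord q₀ = 0
    · -- the cut-off function makes `G` vanish near the zeros of the first coordinate
      have hev : G =ᶠ[nhds (q₀, v₀)] fun _ => 0 := by
        have hcont : Continuous fun a : SU2 × S3 => 2 * ‖firstCoord a.1‖ ^ 2 - 1 := by
          have := hfc.continuous
          fun_prop
        have hneg : 2 * ‖firstCoord (q₀, v₀).1‖ ^ 2 - 1 < 0 := by simp [h0]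
        filter_upwards [hcont.continuousAt.eventually_lt_const hneg] with a ha
        simp only [G, χ]
        rw [Real.smoothTransition.zero_of_nonpos ha.le, zero_mul]
      exact contMDiffAt_const.congr_of_eventuallyEq hev
    · -- near `q₀` there is a smooth choice of an `l`-th root of `z / |z|`
      let θ (z : ℂ) : ℝ := -(((firstCoord q₀).arg + (z / firstCoord q₀).arg) / l)
      have hθ : ContDiffAt ℝ ∞ θ (firstCoord q₀) := by
        have hlog : ContDiffAt ℝ ∞ (fun z : ℂ => Complex.log (z / firstCoord q₀))
            (firstCoord q₀) :=
          ((Complex.contDiffAt_log (by simp [h0])).restrict_scalars ℝ).comp _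
            (contDiffAt_id.div_const _)
        have harg : ContDiffAt ℝ ∞ (fun z : ℂ => (z / firstCoord q₀).arg) (firstCoord q₀) := by
          simpa only [Function.comp_def, Complex.imCLM_apply, Complex.log_im] using
            Complex.imCLM.contDiff.contDiffAt.comp _ hlog
        exact ((contDiffAt_const.add harg).div_const _).neg
      have hev : G =ᶠ[nhds (q₀, v₀)] fun a => χ (firstCoord a.1) *
          F (LensSpace.mk l m n (weightedSMul m n (Circle.exp (θ (firstCoord a.1))) a.2)) := by
        have hne : ∀ᶠ a in nhds (q₀, v₀), firstCoord a.1 ≠ 0 :=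
          hfc.continuous.continuousAt.eventually_ne h0
        filter_upwards [hne] with a ha
        simp only [G, θ]
        rw [Circle.exp_neg, LensSpace.mk_inv_weightedSMul_eq]
        rw [circleRoot_pow hl, ← Circle.exp_nsmul, nsmul_eq_mul,
          mul_div_cancel₀ _ (by exact_mod_cast hl), Circle.exp_add,
          ← exp_arg_mul h0 (div_ne_zero ha h0), mul_div_cancel₀ _ h0]
      refine ContMDiffAt.congr_of_eventuallyEq ?_ hev
      refine ContMDiffAt.mul (hχ.contMDiff.comp hfc).contMDiffAt ?_
      exact LensSpace.contMDiffAt_comp_weightedSMul_exp hF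
        (ContDiffAt.comp_contMDiffAt (g := θ) (x := (q₀, v₀)) hθ hfc.contMDiffAt)
  · intro a
    obtain ⟨v, rfl⟩ := a.exists_mk_eq
    change G (1, v) = _
    have h1 : firstCoord 1 = 1 := by
      rw [← map_one circleToSU2, firstCoord_circleToSU2, Circle.coe_one]
    simp only [G, h1, circleRoot, Complex.arg_one, zero_div, Circle.exp_zero, inv_one,
      one_weightedSMul, χ, norm_one]
    rw [Real.smoothTransition.one_of_one_le (by norm_num), one_mul]
  · intro q v hq
    change G (q, v) = 0
    simp [G, hq, hχ0]

/-- The union of the pieces `{[(p, v)]}` and `{[(p j, v)]}` carries the smooth structure of two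
copies of the lens space: functions on the two pieces extend simultaneously, because the extension from each piece vanishes on the other. -/
theorem isDiffeo_fixedPoints {l : ℕ} (hl : l ≠ 0) {m n : ℕ} {S : Set (NSpace l m n)} (p : SU2)
    (e : LensSpace l m n ⊕ LensSpace l m n ≃ₜ S)
    (hel : ∀ a, (e (Sum.inl a) : NSpace l m n) = lensToNSpace l m n p a)
    (her : ∀ a, (e (Sum.inr a) : NSpace l m n) = lensToNSpace l m n (p * quaternionJ) a) :
    IsDiffeo (inducedSmooth (NSpace.smoothFunctions l m n) S)
      (sumSmooth (LensSpace.smoothFunctions l m n) (LensSpace.smoothFunctions l m n)) e.symm := by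
  have restrict {f : S → ℝ} (hf : f ∈ inducedSmooth (NSpace.smoothFunctions l m n) S) (q : SU2)
      (i : LensSpace l m n → S) (hi : ∀ a, (i a : NSpace l m n) = lensToNSpace l m n q a) :
      (fun a => f (i a)) ∈ LensSpace.smoothFunctions l m n := by
    intro v
    obtain ⟨U, hU, hvU, g, hg, hfg⟩ := hf (i (LensSpace.mk l m n v))
    rw [hi, lensToNSpace_mk] at hvU
    have hq : ContMDiff (𝓡 3) ((𝓡 3).prod (𝓡 3)) ∞ fun w : S3 => ((q, w) : SU2 × S3) :=
      contMDiff_const.prodMk contMDiff_id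
    refine (ContMDiff.comp (g := fun a : SU2 × S3 => g (NSpace.mk l m n a)) hg hq).contMDiffAt.congr_of_eventuallyEq ?_
    have hopen := hU.preimage ((NSpace.continuous_mk l m n).comp hq.continuous)
    filter_upwards [hopen.mem_nhds hvU] with w hw
    have hw' := hi (LensSpace.mk l m n w)
    rw [lensToNSpace_mk] at hw'
    rw [hfg _ (by rw [hw']; exact hw), hw']
    rfl
  intro f
  constructor
  · rintro ⟨hf₁, hf₂⟩ x
    obtain ⟨g₁, hg₁, h₁, h₁'⟩ := exists_smooth_extension hl hf₁
    obtain ⟨g₂, hg₂, h₂, h₂'⟩ := exists_smooth_extension hl hf₂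
    refine ⟨Set.univ, isOpen_univ, Set.mem_univ _,
      fun y => g₁ (p⁻¹ • y) + g₂ ((p * quaternionJ)⁻¹ • y),
      ContMDiff.add (NSpace.smul_mem_smoothFunctions hg₁ _)
        (NSpace.smul_mem_smoothFunctions hg₂ _), fun y _ => ?_⟩
    have key (q r : SU2) (a : LensSpace l m n) :
        q⁻¹ • lensToNSpace l m n r a = lensToNSpace l m n (q⁻¹ * r) a := by
      obtain ⟨v, rfl⟩ := a.exists_mk_eq
      rfl
    obtain ⟨y, rfl⟩ := e.surjective y
    beta_reduce
    rw [e.symm_apply_apply]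
    rcases y with a | a
    · rw [hel, key, key, inv_mul_cancel, h₁]
      obtain ⟨v, rfl⟩ := a.exists_mk_eq
      rw [lensToNSpace_mk, h₂', add_zero]
      rw [mul_inv_rev, inv_mul_cancel_right, firstCoord_inv_quaternionJ]
    · rw [her, key, key, inv_mul_cancel, h₂, inv_mul_cancel_left]
      obtain ⟨v, rfl⟩ := a.exists_mk_eq
      rw [lensToNSpace_mk, h₁', zero_add]
      simpa using firstCoord_quaternionJ_mul_circleToSU2 1
  · intro hf
    refine ⟨?_, ?_⟩
    · simpa using restrict hf p (fun a => e (Sum.inl a)) hel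
    · simpa using restrict hf (p * quaternionJ) (fun a => e (Sum.inr a)) her

/-! ### The lens space determines the order of its group -/

theorem LensSpace.isQuotientCoveringMap_mk {l m n : ℕ} (hl : l ≠ 0) (hm : l.Coprime m)
    (hn : l.Coprime n) :
    letI := rootsAction l m n
    IsQuotientCoveringMap (LensSpace.mk l m n) (rootsSubgroup l) := by
  let := rootsAction l m n
  have := finite_rootsSubgroup hl
  have : ContinuousConstSMul (rootsSubgroup l) S3 :=
    ⟨fun ξ => (continuous_weightedSMul m n).comp (by fun_prop : Continuous fun v : S3 =>
      ((ξ : Circle), v))⟩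
  have : IsCancelSMul (rootsSubgroup l) S3 :=
    isCancelSMul_iff_eq_one_of_smul_eq.2 fun ξ v h =>
      Subtype.ext (eq_one_of_weightedSMul_eq_self hm hn ξ.2 h)
  exact isQuotientCoveringMap_quotientMk_of_properlyDiscontinuousSMul

/-- A homeomorphism of lens spaces embeds the fibres of the covering by `S³` of the one, which have
`l` elements, into the fibres of the other, which have `k` elements. -/
theorem LensSpace.le_of_homeomorph {l m n k m' n' : ℕ} (hl : l ≠ 0) (hm : l.Coprime m)
    (hn : l.Coprime n) (hk : k ≠ 0) (hm' : k.Coprime m') (hn' : k.Coprime n')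
    (h : LensSpace l m n ≃ₜ LensSpace k m' n') : l ≤ k := by
  let := rootsAction l m n
  let := rootsAction k m' n'
  have hp := LensSpace.isQuotientCoveringMap_mk hl hm hn
  have hq := LensSpace.isQuotientCoveringMap_mk hk hm' hn'
  have : PreconnectedSpace S3 := Subtype.preconnectedSpace (isPreconnected_sphere (by
    rw [← Module.finrank_eq_rank, finrank_complexPlane_fact.out]
    norm_num) 0 1)
  obtain ⟨x, φ, hφ⟩ := hp.isCoveringMap.exists_injective_fiber hq.isCoveringMap hq.surjective
    (fun f a b hb => hq.isCoveringMap.exists_lift_sphere (n := 3) (by norm_num) f a b hb)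
    (fun f a b hb => hp.isCoveringMap.exists_lift_sphere (n := 3) (by norm_num) f a b hb)
    h genericVector
  obtain ⟨w, hw⟩ := hq.surjective x
  have e := hp.fiberEquivGroup ⟨genericVector, rfl⟩
  have e' := hq.fiberEquivGroup ⟨w, hw⟩
  have := finite_rootsSubgroup hk
  have := Nat.card_le_card_of_injective (e' ∘ φ ∘ e.symm)
    (e'.injective.comp (hφ.comp e.symm.injective))
  rwa [card_rootsSubgroup hl, card_rootsSubgroup hk] at this

/-! ### Fixed point sets of principal isotropy groups -/

theorem IsPrincipalIsotropy.exists_diffeo_fixedPoints {n₁ n₂ l d : ℕ} (h₁ : Nat.Coprime l n₁)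
    (h₂ : Nat.Coprime l n₂) (hd : 3 ≤ d) {H : Subgroup SU2}
    (hH : IsPrincipalIsotropy (NSpace l n₁ n₂) H)
    (hHd : Nonempty (H ≃* Multiplicative (ZMod d))) :
    l ≠ 0 ∧ ∃ e : MulAction.fixedPoints H (NSpace l n₁ n₂) ≃ₜ
      LensSpace l n₁ n₂ ⊕ LensSpace l n₁ n₂,
      IsDiffeo
        (inducedSmooth (NSpace.smoothFunctions l n₁ n₂)
          (MulAction.fixedPoints H (NSpace l n₁ n₂)))
        (sumSmooth (LensSpace.smoothFunctions l n₁ n₂) (LensSpace.smoothFunctions l n₁ n₂)) e := by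
  obtain ⟨hl, hld, hdm, hdn, p, hp⟩ := hH.exists_mem_iff_conj h₁ h₂ hd hHd
  obtain ⟨e, hel, her⟩ := exists_homeomorph_fixedPoints hl hd hld hdm hdn hp
  exact ⟨hl, e.symm, isDiffeo_fixedPoints hl p e hel her⟩

theorem eq_of_homeomorph_fixedPoints {n₁ n₂ l d : ℕ} (h₁ : Nat.Coprime l n₁)
    (h₂ : Nat.Coprime l n₂) (hd : 3 ≤ d) {H : Subgroup SU2}
    (hH : IsPrincipalIsotropy (NSpace l n₁ n₂) H)
    (hHd : Nonempty (H ≃* Multiplicative (ZMod d)))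
    {m₁ m₂ k c : ℕ} {K : Subgroup SU2} (h₁' : Nat.Coprime k m₁)
    (h₂' : Nat.Coprime k m₂) (hc : 3 ≤ c) (hK : IsPrincipalIsotropy (NSpace k m₁ m₂) K)
    (hKc : Nonempty (K ≃* Multiplicative (ZMod c)))
    (f : MulAction.fixedPoints H (NSpace l n₁ n₂) ≃ₜ MulAction.fixedPoints K (NSpace k m₁ m₂)) :
    k = l := by
  obtain ⟨hl, e, -⟩ := hH.exists_diffeo_fixedPoints h₁ h₂ hd hHd
  obtain ⟨hk, e', -⟩ := hK.exists_diffeo_fixedPoints h₁' h₂' hc hKc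
  obtain ⟨g⟩ := nonempty_homeomorph_of_sum_self ((e.symm.trans f).trans e')
  exact le_antisymm (LensSpace.le_of_homeomorph hk h₁' h₂' hl h₁ h₂ g.symm)
    (LensSpace.le_of_homeomorph hl h₁ h₂ hk h₁' h₂' g)

section Equivariant

variable {G X Y : Type*} [Group G] [MulAction G X] [MulAction G Y]

theorem stabilizer_apply_of_equivariant (e : X ≃ Y) (he : ∀ (g : G) x, e (g • x) = g • e x)
    (x : X) : MulAction.stabilizer G (e x) = MulAction.stabilizer G x := by
  ext g
  rw [MulAction.mem_stabilizer_iff, MulAction.mem_stabilizer_iff, ← he, e.injective.eq_iff]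

theorem IsPrincipalIsotropy.of_equivariant {H : Subgroup G} (hH : IsPrincipalIsotropy X H)
    (e : X ≃ Y) (he : ∀ (g : G) x, e (g • x) = g • e x) : IsPrincipalIsotropy Y H := by
  obtain ⟨⟨x, hx⟩, h⟩ := hH
  refine ⟨⟨e x, by rw [stabilizer_apply_of_equivariant e he, hx]⟩, fun y => ?_⟩
  obtain ⟨x, rfl⟩ := e.surjective y
  rw [stabilizer_apply_of_equivariant e he]
  exact h x

theorem nonempty_homeomorph_fixedPoints_of_equivariant [TopologicalSpace X] [TopologicalSpace Y]
    (e : X ≃ₜ Y) (he : ∀ (g : G) x, e (g • x) = g • e x) (H : Subgroup G) :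
    Nonempty (MulAction.fixedPoints H X ≃ₜ MulAction.fixedPoints H Y) := by
  refine ⟨e.subtype fun x => ?_⟩
  refine forall_congr' fun g => ?_
  change (g : G) • x = x ↔ (g : G) • e x = e x
  rw [← he, e.injective.eq_iff]

end Equivariant

set_option synthInstance.maxHeartbeats 200000 in
/-- A principal isotropy group is carried over by an equivariant homeomorphism, and so is its fixed
point set. -/
theorem eq_of_equivariant_homeomorph {n₁ n₂ l d : ℕ} (h₁ : Nat.Coprime l n₁)
    (h₂ : Nat.Coprime l n₂) (hd : 3 ≤ d) {H : Subgroup SU2}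
    (hH : IsPrincipalIsotropy (NSpace l n₁ n₂) H)
    (hHd : Nonempty (H ≃* Multiplicative (ZMod d)))
    {m₁ m₂ k : ℕ} (h₁' : Nat.Coprime k m₁) (h₂' : Nat.Coprime k m₂)
    (e : NSpace l n₁ n₂ ≃ₜ NSpace k m₁ m₂) (he : ∀ (g : SU2) x, e (g • x) = g • e x) : k = l := by
  obtain ⟨f⟩ := nonempty_homeomorph_fixedPoints_of_equivariant e he H
  exact eq_of_homeomorph_fixedPoints h₁ h₂ hd hH hHd h₁' h₂' hd
    (hH.of_equivariant e.toEquiv he) hHd f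

theorem mainTheorem8 (n₁ n₂ l d : ℕ) (h₁ : Nat.Coprime l n₁) (h₂ : Nat.Coprime l n₂)
    (hd : 3 ≤ d) (H : Subgroup SU2) (hH : IsPrincipalIsotropy (NSpace l n₁ n₂) H)
    (hHd : Nonempty (H ≃* Multiplicative (ZMod d))) :
    -- the group of `l`-th roots of unity has order `l ≥ 1` and acts freely on `S³`
    (0 < l ∧ Nat.card (rootsSubgroup l) = l ∧
      ∀ (ξ : rootsSubgroup l) (v : S3), (rootsAction l n₁ n₂).smul ξ v = v → ξ = 1) ∧
    -- the fixed point set of `H` is diffeomorphic to two copies of the lens space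
    (∃ e : MulAction.fixedPoints H (NSpace l n₁ n₂) ≃ₜ LensSpace l n₁ n₂ ⊕ LensSpace l n₁ n₂,
      IsDiffeo
        (inducedSmooth (NSpace.smoothFunctions l n₁ n₂)
          (MulAction.fixedPoints H (NSpace l n₁ n₂)))
        (sumSmooth (LensSpace.smoothFunctions l n₁ n₂) (LensSpace.smoothFunctions l n₁ n₂)) e) ∧
    -- the topological type of the fixed point set determines `l`
    (∀ (m₁ m₂ k c : ℕ) (K : Subgroup SU2), Nat.Coprime k m₁ → Nat.Coprime k m₂ → 3 ≤ c →
      IsPrincipalIsotropy (NSpace k m₁ m₂) K → Nonempty (K ≃* Multiplicative (ZMod c)) →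
      Nonempty (MulAction.fixedPoints H (NSpace l n₁ n₂) ≃ₜ
        MulAction.fixedPoints K (NSpace k m₁ m₂)) → k = l) ∧
    -- in particular equivariantly homeomorphic actions have the same `l`
    (∀ m₁ m₂ k : ℕ, Nat.Coprime k m₁ → Nat.Coprime k m₂ →
      (∃ e : NSpace l n₁ n₂ ≃ₜ NSpace k m₁ m₂,
        ∀ (g : SU2) (x : NSpace l n₁ n₂), e (g • x) = g • e x) → k = l) := by
  obtain ⟨hl, he⟩ := hH.exists_diffeo_fixedPoints h₁ h₂ hd hHd
  refine ⟨⟨Nat.pos_of_ne_zero hl, card_rootsSubgroup hl, fun ξ v h => ?_⟩, he, ?_, ?_⟩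
  · exact Subtype.ext (eq_one_of_weightedSMul_eq_self h₁ h₂ ξ.2 h)
  · rintro m₁ m₂ k c K h₁' h₂' hc hK hKc ⟨f⟩
    exact eq_of_homeomorph_fixedPoints h₁ h₂ hd hH hHd h₁' h₂' hc hK hKc f
  · rintro m₁ m₂ k h₁' h₂' ⟨e, he⟩
    exact eq_of_equivariant_homeomorph h₁ h₂ hd hH hHd h₁' h₂' e he

end
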